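/- Let $H=\{(t,u)\in\mathbb{R}\times\mathbb{R}^3 : t>0,\ |u|^2-t^2=-1\}$ be three-dimensional hyperbolic space (the future unit hyperboloid in Minkowski space), with hyperbolic distance $d$, $\cosh d\big((t,u),(t',u')\big)=tt'-u\cdot u'$, and with its standard Riemannian volume measure $\mathrm{d}x$. For $p\ge 0$ put $$K_p(x,y)=\frac{\sin (pr)}{p\,\sinh r},\qquad r=d(x,y),$$ extended continuously to $p=0$ and $r=0$, so that $K_0(x,y)=r/\sinh r$ for $r>0$ and $K_p(x,x)=1$. A relativistic spin network is a finite graph with vertex set $V$ and edge set $E$ together with a label $p_e\ge 0$ for each edge $e\in E$. It is called integrable if for every vertex $w\in V$ and every point $x_w\in H$ the function $$(x_v)_{v\in V\setminus\{w\}}\ \longmapsto\ \prod_{e=\{a,b\}\in E}K_{p_e}(x_a,x_b)$$ is Lebesgue integrable on $H^{V\setminus\{w\}}$ with respect to $\prod_{v\ne w}\mathrm{d}x_v$, i.e. the integral of its absolute value is finite. A graph is called integrable if the network is integrable for every choice of labels $p_e\ge 0$. **Theorem.** The 4-simplex, i.e. the complete graph on $5$ vertices, is integrable. -/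

import Mathlib

open MeasureTheory

noncomputable section

/-- Euclidean three-space. -/
abbrev E3 : Type := EuclideanSpace ℝ (Fin 3)

/-- The Minkowski bilinear form, of signature `(-,+,+,+)`, on `ℝ × ℝ³` (time component first). -/
def minkowski (x y : ℝ × E3) : ℝ := inner ℝ x.2 y.2 - x.1 * y.1

/-- Three-dimensional hyperbolic space: the future sheet of the unit hyperboloid. Its topology and
Borel σ-algebra are those of a subspace of `ℝ × ℝ³`. -/
abbrev Hyp3 : Type := {x : ℝ × E3 // 0 < x.1 ∧ minkowski x x = -1}

/-- The hyperbolic distance, characterised by `cosh (d x y) = -⟨x, y⟩`. -/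
def hypDist (x y : Hyp3) : ℝ := Real.arcosh (-minkowski x.1 y.1)

theorem hypDist_comm (x y : Hyp3) : hypDist x y = hypDist y x := by
  simp only [hypDist, minkowski, real_inner_comm, mul_comm]

/-- The global parametrisation `u ↦ (√(1 + |u|²), u)` of the hyperboloid, as a map into `ℝ × ℝ³`. -/
def hypParam (u : E3) : ℝ × E3 := (Real.sqrt (1 + ‖u‖ ^ 2), u)

theorem hypParam_mem (u : E3) :
    0 < (hypParam u).1 ∧ minkowski (hypParam u) (hypParam u) = -1 := by
  have h : (0 : ℝ) < 1 + ‖u‖ ^ 2 := by positivity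
  refine ⟨Real.sqrt_pos.2 h, ?_⟩
  simp only [minkowski, hypParam, real_inner_self_eq_norm_sq, Real.mul_self_sqrt h.le]
  ring

/-- The global parametrisation of hyperbolic space by `ℝ³`. -/
def hypChart (u : E3) : Hyp3 := ⟨hypParam u, hypParam_mem u⟩

/-- The matrix of the Riemannian metric of hyperbolic space (the restriction of the Minkowski form
to tangent vectors of the hyperboloid) in the global parametrisation. -/
def hypMetric (u : E3) : Matrix (Fin 3) (Fin 3) ℝ :=
  Matrix.of fun i j =>
    minkowski (fderiv ℝ hypParam u (EuclideanSpace.single i 1))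
      (fderiv ℝ hypParam u (EuclideanSpace.single j 1))

/-- The Riemannian volume measure of hyperbolic space: `√(det g) du` in the global
parametrisation. -/
def hypVolume : Measure Hyp3 :=
  ((volume : Measure E3).withDensity
    fun u => ENNReal.ofReal (Real.sqrt (hypMetric u).det)).map hypChart

/-- The kernel `K_p(r) = sin (p r) / (p sinh r)`, extended continuously to `p = 0` and `r = 0`. -/
def zonalKernel (p r : ℝ) : ℝ :=
  if r = 0 then 1
  else if p = 0 then r / Real.sinh r
  else Real.sin (p * r) / (p * Real.sinh r)

/-- The factor `K_p(x_a, x_b)` attached to an edge with label `p` and endpoints `a`, `b`, where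
`x` places the vertices in hyperbolic space. -/
def edgeFactor {V : Type*} (p : ℝ) (x : V → Hyp3) (e : Sym2 V) : ℝ :=
  Sym2.lift ⟨fun a b => zonalKernel p (hypDist (x a) (x b)), fun a b => by
    simp only [hypDist_comm]⟩ e

/-- The placement of all vertices that sends `w` to `xw` and any other vertex `v` to `y v`. -/
def placement {V : Type*} [DecidableEq V] (w : V) (xw : Hyp3) (y : {v : V // v ≠ w} → Hyp3) :
    V → Hyp3 :=
  fun v => if h : v = w then xw else y ⟨v, h⟩

/-- A relativistic spin network on the finite (multi)graph with vertex set `V`, edge set `E` and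
endpoints `ends`, with edge labels `p`, is integrable if, whichever vertex `w` is chosen to be
omitted from the integration and wherever it is placed, the product of the edge factors is
Lebesgue integrable over the positions of the remaining vertices. -/
def SpinNetworkIntegrable {V E : Type*} [Fintype V] [DecidableEq V] [Fintype E]
    (ends : E → Sym2 V) (p : E → ℝ) : Prop :=
  ∀ (w : V) (xw : Hyp3),
    Integrable
      (fun y : {v : V // v ≠ w} → Hyp3 => ∏ e : E, edgeFactor (p e) (placement w xw y) (ends e))
      (Measure.pi fun _ => hypVolume)

/-- A graph is integrable if it gives an integrable network for all values `p e ≥ 0` of the edge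
labels. -/
def GraphIntegrable {V E : Type*} [Fintype V] [DecidableEq V] [Fintype E]
    (ends : E → Sym2 V) : Prop :=
  ∀ p : E → ℝ, (∀ e, 0 ≤ p e) → SpinNetworkIntegrable ends p

/-- The 4-simplex: the endpoints of the edges of the complete graph on five vertices. -/
def fourSimplexEnds : (⊤ : SimpleGraph (Fin 5)).edgeSet → Sym2 (Fin 5) := Subtype.val

end

/-!
Since `|sin (p r)| ≤ p r`, every kernel is bounded by `k = K_0`, where `k(r) = r / sinh r`. As
hyperbolic volume grows like `e ^ (2 r)`, the function `k(d(x, ·))` lies in `L^q` exactly for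
`q > 2`. The complete graph on five vertices is just dense enough to exploit this. Each of its ten
edges lies in exactly two of its five stars (a star being a vertex together with its four edges),
so the arithmetic-geometric mean inequality gives

  `∏_e k_e = ∏_v (∏_{e ∋ v} k_e ^ (5 / 2)) ^ (1 / 5) ≤ (1 / 5) ∑_v ∏_{e ∋ v} k_e ^ (5 / 2)`,

and `5 / 2 > 2` (`prod_edges_le_sum_stars`). A star is a tree, so its integral factorises: the
leaves are integrated out first, and then the centre if it is not the vertex held fixed
(`lintegral_star_fixed_le`, `lintegral_star_moving_le`). For this one needs that
`∫ k(d(x, y)) ^ (5 / 2) dy` is finite and does not depend on `x`.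

Independence of `x` is the Lorentz invariance of the volume, which in the global chart is
`du / √(1 + |u|²)` (`lintegral_hypVolume`). The isometry used is the involution `hypSwap a` that
exchanges the origin and the point with coordinate `a`; its derivative is, up to sign, a
transvection, whose determinant is exactly the ratio of the two densities (`lintegral_hypDist`).
Finiteness is then a computation around the origin (`starConst_lt_top`).
-/

/-! ### The volume measure in the global chart -/

theorem one_add_norm_sq_pos (u : E3) : 0 < 1 + ‖u‖ ^ 2 := by positivity

theorem hasFDerivAt_sqrt_one_add_norm_sq (u : E3) :
    HasFDerivAt (fun v : E3 => Real.sqrt (1 + ‖v‖ ^ 2))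
      ((Real.sqrt (1 + ‖u‖ ^ 2))⁻¹ • innerSL ℝ u) u := by
  have h := ((hasStrictFDerivAt_norm_sq u).hasFDerivAt.const_add 1).sqrt
    (one_add_norm_sq_pos u).ne'
  refine h.congr_fderiv ?_
  rw [← Nat.cast_smul_eq_nsmul ℝ, smul_smul]
  congr 1
  have := Real.sqrt_pos.2 (one_add_norm_sq_pos u)
  push_cast
  field_simp

theorem hypMetric_apply (u : E3) (i j : Fin 3) :
    hypMetric u i j = (if i = j then 1 else 0) - u i * u j / (1 + ‖u‖ ^ 2) := by
  have h : HasFDerivAt hypParam (((Real.sqrt (1 + ‖u‖ ^ 2))⁻¹ • innerSL ℝ u).prod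
      (ContinuousLinearMap.id ℝ E3)) u :=
    (hasFDerivAt_sqrt_one_add_norm_sq u).prodMk (hasFDerivAt_id u)
  have hs : (1 + ‖u‖ ^ 2)⁻¹ = (Real.sqrt (1 + ‖u‖ ^ 2))⁻¹ * (Real.sqrt (1 + ‖u‖ ^ 2))⁻¹ := by
    rw [← mul_inv, Real.mul_self_sqrt (one_add_norm_sq_pos u).le]
  simp only [hypMetric, Matrix.of_apply, h.fderiv, minkowski]
  simp [EuclideanSpace.inner_single_right, eq_comm]
  rw [div_eq_mul_inv, hs]
  ring

theorem sqrt_det_hypMetric (u : E3) :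
    Real.sqrt (hypMetric u).det = (Real.sqrt (1 + ‖u‖ ^ 2))⁻¹ := by
  have hn : ‖u‖ ^ 2 = u 0 ^ 2 + u 1 ^ 2 + u 2 ^ 2 := by
    simp [EuclideanSpace.norm_sq_eq, Fin.sum_univ_three]
  have hp := one_add_norm_sq_pos u
  rw [← Real.sqrt_inv]
  congr 1
  rw [Matrix.det_fin_three]
  simp only [hypMetric_apply]
  simp
  field_simp
  rw [hn]
  ring

theorem measurable_hypChart : Measurable hypChart := by
  refine Measurable.subtype_mk ?_
  unfold hypParam
  fun_prop

/-- The global chart, as an isomorphism of measurable spaces. -/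
noncomputable def hypChartEquiv : E3 ≃ᵐ Hyp3 where
  toFun := hypChart
  invFun x := x.1.2
  left_inv _ := rfl
  right_inv x := by
    obtain ⟨⟨t, u⟩, ht, h⟩ := x
    simp only [minkowski, real_inner_self_eq_norm_sq] at h ht
    have : Real.sqrt (1 + ‖u‖ ^ 2) = t := by
      rw [show 1 + ‖u‖ ^ 2 = t ^ 2 by linarith, Real.sqrt_sq ht.le]
    exact Subtype.ext (Prod.ext this rfl)
  measurable_toFun := measurable_hypChart
  measurable_invFun := measurable_snd.comp measurable_subtype_coe

instance : SigmaFinite hypVolume := hypChartEquiv.sigmaFinite_map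

theorem lintegral_hypVolume {f : Hyp3 → ENNReal} (hf : Measurable f) :
    ∫⁻ x, f x ∂hypVolume =
      ∫⁻ u : E3, ENNReal.ofReal (Real.sqrt (1 + ‖u‖ ^ 2))⁻¹ * f (hypChart u) := by
  rw [hypVolume, lintegral_map hf measurable_hypChart]
  simp only [sqrt_det_hypMetric]
  exact lintegral_withDensity_eq_lintegral_mul _ (by fun_prop) (hf.comp measurable_hypChart)

/-! ### Lorentz invariance -/

/-- The coefficient of `a` in `hypSwap a u`. -/
noncomputable def hypSwapCoeff (a u : E3) : ℝ :=
  Real.sqrt (1 + ‖u‖ ^ 2) - inner ℝ a u / (1 + Real.sqrt (1 + ‖a‖ ^ 2))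

/-- The isometric involution of hyperbolic space that exchanges the origin and the point with
coordinate `a`, in the global chart. It is the restriction of the linear isometry of Minkowski space
that is the identity on the line spanned by the sum of these two points and `-1` on the orthogonal
complement of that line. -/
noncomputable def hypSwap (a u : E3) : E3 := hypSwapCoeff a u • a - u

theorem inner_hypSwap (a u : E3) :
    inner ℝ a (hypSwap a u) = hypSwapCoeff a u * ‖a‖ ^ 2 - inner ℝ a u := by
  rw [hypSwap, inner_sub_right, inner_smul_right, real_inner_self_eq_norm_sq]

theorem sqrt_one_add_norm_hypSwap_sq (a u : E3) :
    Real.sqrt (1 + ‖hypSwap a u‖ ^ 2) =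
      Real.sqrt (1 + ‖a‖ ^ 2) * Real.sqrt (1 + ‖u‖ ^ 2) - inner ℝ a u := by
  have hA := Real.sq_sqrt (one_add_norm_sq_pos a).le
  have hU := Real.sq_sqrt (one_add_norm_sq_pos u).le
  have hA0 := Real.sqrt_pos.2 (one_add_norm_sq_pos a)
  have hle : inner ℝ a u ≤ Real.sqrt (1 + ‖a‖ ^ 2) * Real.sqrt (1 + ‖u‖ ^ 2) :=
    (real_inner_le_norm a u).trans <| mul_le_mul (Real.le_sqrt_of_sq_le (by linarith))
      (Real.le_sqrt_of_sq_le (by linarith)) (norm_nonneg _) hA0.le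
  rw [← Real.sqrt_sq (sub_nonneg.2 hle), hypSwap, norm_sub_sq_real, norm_smul, inner_smul_left,
    mul_pow, Real.norm_eq_abs, sq_abs]
  congr 1
  simp only [hypSwapCoeff, conj_trivial]
  generalize Real.sqrt (1 + ‖a‖ ^ 2) = A at *
  generalize Real.sqrt (1 + ‖u‖ ^ 2) = U at *
  rw [show ‖a‖ ^ 2 = A ^ 2 - 1 by linarith, show ‖u‖ ^ 2 = U ^ 2 - 1 by linarith]
  field_simp
  ring

theorem hypSwap_involutive (a : E3) : Function.Involutive (hypSwap a) := by
  intro u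
  have hA := Real.sq_sqrt (one_add_norm_sq_pos a).le
  have hA0 := Real.sqrt_pos.2 (one_add_norm_sq_pos a)
  have h : hypSwapCoeff a (hypSwap a u) = hypSwapCoeff a u := by
    rw [hypSwapCoeff, sqrt_one_add_norm_hypSwap_sq, inner_hypSwap]
    simp only [hypSwapCoeff]
    generalize Real.sqrt (1 + ‖a‖ ^ 2) = A at *
    rw [show ‖a‖ ^ 2 = A ^ 2 - 1 by linarith]
    field_simp
    ring
  rw [hypSwap, h, hypSwap, sub_sub_cancel]

theorem hypDist_hypSwap (a u : E3) :
    hypDist (hypChart a) (hypChart (hypSwap a u)) = Real.arcosh (Real.sqrt (1 + ‖u‖ ^ 2)) := by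
  have hA := Real.sq_sqrt (one_add_norm_sq_pos a).le
  have hA0 := Real.sqrt_pos.2 (one_add_norm_sq_pos a)
  rw [hypDist]
  congr 1
  simp only [minkowski, hypChart, hypParam]
  rw [sqrt_one_add_norm_hypSwap_sq, inner_hypSwap, hypSwapCoeff]
  generalize Real.sqrt (1 + ‖a‖ ^ 2) = A at *
  rw [show ‖a‖ ^ 2 = A ^ 2 - 1 by linarith]
  field_simp
  ring

/-- The derivative of `hypSwap a` at `u`. -/
noncomputable def hypSwapDeriv (a u : E3) : E3 →L[ℝ] E3 :=
  ((Real.sqrt (1 + ‖u‖ ^ 2))⁻¹ • innerSL ℝ u -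
    (1 + Real.sqrt (1 + ‖a‖ ^ 2))⁻¹ • innerSL ℝ a).smulRight a - ContinuousLinearMap.id ℝ E3

theorem hasFDerivAt_hypSwap (a u : E3) : HasFDerivAt (hypSwap a) (hypSwapDeriv a u) u := by
  have h1 : HasFDerivAt (fun v : E3 => inner ℝ a v / (1 + Real.sqrt (1 + ‖a‖ ^ 2)))
      ((1 + Real.sqrt (1 + ‖a‖ ^ 2))⁻¹ • innerSL ℝ a) u := by
    simpa [div_eq_inv_mul] using
      (innerSL ℝ a).hasFDerivAt.const_mul (1 + Real.sqrt (1 + ‖a‖ ^ 2))⁻¹ (x := u)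
  exact (((hasFDerivAt_sqrt_one_add_norm_sq u).sub h1).smul_const a).sub (hasFDerivAt_id u)

/-- Up to sign the derivative is the identity plus a map of rank one, hence a transvection. -/
theorem abs_det_hypSwapDeriv (a u : E3) :
    |(hypSwapDeriv a u).det| =
      Real.sqrt (1 + ‖hypSwap a u‖ ^ 2) * (Real.sqrt (1 + ‖u‖ ^ 2))⁻¹ := by
  have hA := Real.sq_sqrt (one_add_norm_sq_pos a).le
  have hA0 := Real.sqrt_pos.2 (one_add_norm_sq_pos a)
  have hU0 := Real.sqrt_pos.2 (one_add_norm_sq_pos u)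
  have h : (hypSwapDeriv a u : E3 →ₗ[ℝ] E3) =
      (-1 : ℝ) • LinearMap.transvection (((Real.sqrt (1 + ‖u‖ ^ 2))⁻¹ • innerSL ℝ u -
        (1 + Real.sqrt (1 + ‖a‖ ^ 2))⁻¹ • innerSL ℝ a : E3 →L[ℝ] ℝ) : E3 →ₗ[ℝ] ℝ) (-a) := by
    ext v : 1
    simp [hypSwapDeriv, LinearMap.transvection.apply, sub_smul]
    abel
  have hq : |(hypSwapDeriv a u).det| =
      |Real.sqrt (1 + ‖hypSwap a u‖ ^ 2) * (Real.sqrt (1 + ‖u‖ ^ 2))⁻¹| := by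
    rw [ContinuousLinearMap.det, h, LinearMap.det_smul, LinearMap.transvection.det, abs_mul,
      abs_pow, abs_neg, abs_one, one_pow, one_mul, sqrt_one_add_norm_hypSwap_sq]
    congr 1
    simp only [ContinuousLinearMap.coe_coe, map_neg, sub_apply, smul_apply,
      innerSL_apply_apply, real_inner_self_eq_norm_sq, smul_eq_mul, real_inner_comm a u]
    generalize Real.sqrt (1 + ‖a‖ ^ 2) = A at *
    rw [show ‖a‖ ^ 2 = A ^ 2 - 1 by linarith]
    field_simp
    ring
  rw [hq, abs_of_nonneg (by positivity)]

theorem measurable_hypDist : Measurable hypDist.uncurry := by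
  simp only [Function.uncurry_def, hypDist, Real.arcosh, minkowski]
  fun_prop

/-- The integral of a function of the distance to a point does not depend on that point. -/
theorem lintegral_hypDist {f : ℝ → ENNReal} (hf : Measurable f) (x : Hyp3) :
    ∫⁻ y, f (hypDist x y) ∂hypVolume =
      ∫⁻ u : E3, ENNReal.ofReal (Real.sqrt (1 + ‖u‖ ^ 2))⁻¹ *
        f (Real.arcosh (Real.sqrt (1 + ‖u‖ ^ 2))) := by
  obtain ⟨a, rfl⟩ : ∃ a, hypChart a = x := hypChartEquiv.surjective x
  have hm : Measurable fun y => f (hypDist (hypChart a) y) :=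
    hf.comp measurable_hypDist.of_uncurry_left
  rw [lintegral_hypVolume hm]
  have h := lintegral_image_eq_lintegral_abs_det_fderiv_mul volume MeasurableSet.univ
    (fun u _ => (hasFDerivAt_hypSwap a u).hasFDerivWithinAt) (hypSwap_involutive a).injective.injOn
    (fun u => ENNReal.ofReal (Real.sqrt (1 + ‖u‖ ^ 2))⁻¹ * f (hypDist (hypChart a) (hypChart u)))
  rw [Set.image_univ, (hypSwap_involutive a).surjective.range_eq] at h
  simp only [Measure.restrict_univ] at h
  rw [h]
  refine lintegral_congr fun u => ?_
  rw [hypDist_hypSwap, ← mul_assoc, ← ENNReal.ofReal_mul (abs_nonneg _), abs_det_hypSwapDeriv]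
  congr 2
  have := Real.sqrt_pos.2 (one_add_norm_sq_pos (hypSwap a u))
  field_simp

/-! ### Bounds on the kernel -/

theorem Measurable.comp_pair {α X Y : Type*} [MeasurableSpace α] [MeasurableSpace X]
    [MeasurableSpace Y] {g : X → X → Y} (hg : Measurable g.uncurry) {a b : α → X}
    (ha : Measurable a) (hb : Measurable b) : Measurable fun t => g (a t) (b t) :=
  hg.comp (ha.prodMk hb)

theorem measurable_zonalKernel (p : ℝ) : Measurable (zonalKernel p) := by
  unfold zonalKernel
  refine Measurable.ite (measurableSet_singleton 0) measurable_const ?_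
  split_ifs <;> fun_prop

theorem zonalKernel_zero_eq (r : ℝ) :
    zonalKernel 0 r = if r = 0 then 1 else r / Real.sinh r := by
  simp [zonalKernel]

theorem zonalKernel_zero_eq_abs (r : ℝ) :
    zonalKernel 0 r = if r = 0 then 1 else |r| / |Real.sinh r| := by
  rw [zonalKernel_zero_eq]
  split_ifs with h
  · rfl
  rw [← abs_div, abs_of_nonneg]
  rcases le_total 0 r with hr | hr
  · exact div_nonneg hr (Real.sinh_nonneg_iff.2 hr)
  · exact div_nonneg_of_nonpos hr (Real.sinh_nonpos_iff.2 hr)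

theorem zonalKernel_zero_nonneg (r : ℝ) : 0 ≤ zonalKernel 0 r := by
  rw [zonalKernel_zero_eq_abs]
  split_ifs <;> positivity

theorem abs_zonalKernel_le (p r : ℝ) : |zonalKernel p r| ≤ zonalKernel 0 r := by
  rw [zonalKernel_zero_eq_abs, zonalKernel]
  split_ifs with hr hp
  · simp
  · rw [abs_div]
  · have hs : 0 < |Real.sinh r| := abs_pos.2 (Real.sinh_eq_zero.not.2 hr)
    have hp' : 0 < |p| := abs_pos.2 hp
    rw [abs_div, abs_mul, div_le_div_iff₀ (by positivity) hs]
    calc |Real.sin (p * r)| * |Real.sinh r| ≤ |p * r| * |Real.sinh r| := by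
          exact mul_le_mul_of_nonneg_right Real.abs_sin_le_abs (abs_nonneg _)
      _ = |r| * (|p| * |Real.sinh r|) := by rw [abs_mul]; ring

theorem arcosh_sqrt_one_add_sq {s : ℝ} (hs : 0 ≤ s) :
    Real.arcosh (Real.sqrt (1 + s ^ 2)) = Real.arsinh s := by
  rw [← Real.cosh_arsinh, Real.arcosh_cosh (Real.arsinh_nonneg_iff.2 hs)]

theorem arsinh_le_self {s : ℝ} (hs : 0 ≤ s) : Real.arsinh s ≤ s := by
  conv_rhs => rw [← Real.sinh_arsinh s]
  exact Real.self_le_sinh_iff.2 (Real.arsinh_nonneg_iff.2 hs)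

/-- The exponent `1 / 10` is small enough for the kernel to be integrable, since
`5 / 2 * (1 - 1 / 10) + 1 = 13 / 4` exceeds the dimension `3`. -/
theorem arsinh_le_rpow {s : ℝ} (hs : 0 ≤ s) :
    Real.arsinh s ≤ 20 * (1 + s) ^ (1 / 10 : ℝ) := by
  have h1 : Real.sqrt (1 + s ^ 2) ≤ 1 + s := Real.sqrt_le_iff.2 ⟨by positivity, by nlinarith⟩
  have h0 := Real.sqrt_nonneg (1 + s ^ 2)
  have h2 : (2 : ℝ) ^ (1 / 10 : ℝ) ≤ 2 := by
    conv_rhs => rw [← Real.rpow_one 2]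
    exact Real.rpow_le_rpow_of_exponent_le one_le_two (by norm_num)
  calc Real.arsinh s ≤ Real.log (2 * (1 + s)) := by
        rw [Real.arsinh]
        refine Real.log_le_log ?_ (by linarith)
        have := Real.sqrt_pos.2 (show 0 < 1 + s ^ 2 by positivity)
        linarith
    _ ≤ (2 * (1 + s)) ^ (1 / 10 : ℝ) / (1 / 10) :=
        Real.log_le_rpow_div (by positivity) (by norm_num)
    _ = 10 * ((2 : ℝ) ^ (1 / 10 : ℝ) * (1 + s) ^ (1 / 10 : ℝ)) := by
        rw [Real.mul_rpow zero_le_two (by positivity)]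
        ring
    _ ≤ 10 * (2 * (1 + s) ^ (1 / 10 : ℝ)) := by gcongr
    _ = _ := by ring

/-- In terms of `s = sinh r` the kernel is `arsinh s / s`, which decays like `log s / s`. -/
theorem zonalKernel_zero_arsinh_le {s : ℝ} (hs : 0 ≤ s) :
    zonalKernel 0 (Real.arsinh s) ≤ 40 * (1 + s) ^ (-(9 / 10) : ℝ) := by
  have h1 : (1 + s) * (1 + s) ^ (-(9 / 10) : ℝ) = (1 + s) ^ (1 / 10 : ℝ) := by
    rw [← Real.rpow_one_add' (by positivity) (by norm_num)]
    norm_num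
  have h2 : (1 : ℝ) ≤ (1 + s) ^ (1 / 10 : ℝ) := Real.one_le_rpow (by linarith) (by norm_num)
  have h3 : 0 < (1 + s) ^ (-(9 / 10) : ℝ) := Real.rpow_pos_of_pos (by linarith) _
  rw [zonalKernel_zero_eq, Real.sinh_arsinh]
  rcases le_or_gt s 1 with hs1 | hs1
  · have : (if Real.arsinh s = 0 then 1 else Real.arsinh s / s) ≤ 1 := by
      split_ifs
      · rfl
      · exact div_le_one_of_le₀ (arsinh_le_self hs) hs
    nlinarith
  · rw [if_neg (Real.arsinh_eq_zero_iff.not.2 (by linarith)), div_le_iff₀ (by linarith)]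
    have := arsinh_le_rpow hs
    nlinarith

/-- The power `5 / 2` of the kernel `K_0`, as a function of two points. -/
noncomputable def starWeight (x y : Hyp3) : ENNReal :=
  ENNReal.ofReal (zonalKernel 0 (hypDist x y) ^ (5 / 2 : ℝ))

theorem measurable_starWeight : Measurable starWeight.uncurry :=
  (((measurable_zonalKernel 0).comp measurable_hypDist).pow_const _).ennreal_ofReal

/-- The value of `∫ K_0(x, y) ^ (5 / 2) dy`, which is the same for all `x`. -/
noncomputable def starConst : ENNReal :=
  ∫⁻ u : E3, ENNReal.ofReal (Real.sqrt (1 + ‖u‖ ^ 2))⁻¹ *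
    ENNReal.ofReal (zonalKernel 0 (Real.arcosh (Real.sqrt (1 + ‖u‖ ^ 2))) ^ (5 / 2 : ℝ))

theorem lintegral_starWeight (x : Hyp3) : ∫⁻ y, starWeight x y ∂hypVolume = starConst :=
  lintegral_hypDist ((measurable_zonalKernel 0).pow_const _).ennreal_ofReal x

/-- The integrand decays like `|u| ^ (-13 / 4)`, which is integrable at infinity in dimension
three. -/
theorem starConst_lt_top : starConst < ⊤ := by
  have hfin : (∫⁻ u : E3, ENNReal.ofReal ((1 + ‖u‖) ^ (-(13 / 4) : ℝ))) < ⊤ :=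
    finite_integral_one_add_norm (by simp; norm_num)
  refine lt_of_le_of_lt (lintegral_mono fun u => ?_)
    ((lintegral_const_mul' (ENNReal.ofReal (2 * 40 ^ (5 / 2 : ℝ))) _ ENNReal.ofReal_ne_top).trans_lt
      (ENNReal.mul_lt_top ENNReal.ofReal_lt_top hfin))
  have hu := norm_nonneg u
  rw [← ENNReal.ofReal_mul (by positivity), ← ENNReal.ofReal_mul (by positivity),
    arcosh_sqrt_one_add_sq hu]
  refine ENNReal.ofReal_le_ofReal ?_
  have h1 : (Real.sqrt (1 + ‖u‖ ^ 2))⁻¹ ≤ 2 * (1 + ‖u‖)⁻¹ := by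
    rw [← div_eq_mul_inv, inv_le_comm₀ (Real.sqrt_pos.2 (one_add_norm_sq_pos u)) (by positivity),
      inv_div]
    exact Real.le_sqrt_of_sq_le (by nlinarith [sq_nonneg (1 - ‖u‖)])
  have h2 : zonalKernel 0 (Real.arsinh ‖u‖) ^ (5 / 2 : ℝ) ≤
      40 ^ (5 / 2 : ℝ) * (1 + ‖u‖) ^ (-(9 / 4) : ℝ) := by
    refine (Real.rpow_le_rpow (zonalKernel_zero_nonneg _) (zonalKernel_zero_arsinh_le hu)
      (by norm_num)).trans_eq ?_
    rw [Real.mul_rpow (by norm_num) (by positivity), ← Real.rpow_mul (by positivity)]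
    norm_num
  calc _ ≤ (2 * (1 + ‖u‖)⁻¹) * (40 ^ (5 / 2 : ℝ) * (1 + ‖u‖) ^ (-(9 / 4) : ℝ)) :=
        mul_le_mul h1 h2 (Real.rpow_nonneg (zonalKernel_zero_nonneg _) _) (by positivity)
    _ = 2 * 40 ^ (5 / 2 : ℝ) * ((1 + ‖u‖) ^ (-1 : ℝ) * (1 + ‖u‖) ^ (-(9 / 4) : ℝ)) := by
        rw [Real.rpow_neg_one]; ring
    _ = _ := by
        rw [← Real.rpow_add (by positivity)]; norm_num

/-! ### Products over stars -/

/-- Integrating out the leaves of a star one at a time: if `c` is a centre that does not depend on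
the variables in `s`, every leaf contributes at most a factor `C`. -/
theorem lmarginal_star_le {ι X : Type*} [DecidableEq ι] [MeasurableSpace X] {μ : Measure X}
    [SigmaFinite μ] {g : X → X → ENNReal} (hg : Measurable g.uncurry) {C : ENNReal}
    (hC : ∀ x, ∫⁻ y, g x y ∂μ ≤ C) {h : X → ENNReal} (hh : Measurable h)
    {c : (ι → X) → X} (hc : Measurable c) (s : Finset ι)
    (hcs : ∀ i ∈ s, ∀ x z, c (Function.update x i z) = c x) (x : ι → X) :
    lmarginal (fun _ => μ) s (fun y => h (c y) * ∏ u ∈ s, g (c y) (y u)) x ≤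
      h (c x) * C ^ s.card := by
  induction s using Finset.induction generalizing x with
  | empty => simp
  | insert i s hi ih =>
    have hm (t : Finset ι) : Measurable fun y : ι → X => h (c y) * ∏ u ∈ t, g (c y) (y u) :=
      (hh.comp hc).mul (Finset.measurable_prod _ fun u _ =>
        hg.comp (hc.prodMk (measurable_pi_apply u)))
    rw [lmarginal_insert' _ (hm _) hi]
    have hstep : (fun y : ι → X => ∫⁻ z, (fun y => h (c y) * ∏ u ∈ insert i s, g (c y) (y u))
        (Function.update y i z) ∂μ) ≤
        C • fun y : ι → X => h (c y) * ∏ u ∈ s, g (c y) (y u) := by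
      intro y
      have he (z : X) : h (c (Function.update y i z)) * ∏ u ∈ insert i s,
          g (c (Function.update y i z)) (Function.update y i z u) =
          (h (c y) * ∏ u ∈ s, g (c y) (y u)) * g (c y) z := by
        rw [hcs i (Finset.mem_insert_self i s), Finset.prod_insert hi, Function.update_self,
          Finset.prod_congr rfl fun u hu => by
            rw [Function.update_of_ne (ne_of_mem_of_not_mem hu hi)]]
        ring
      simp only [he, Pi.smul_apply, smul_eq_mul]
      rw [lintegral_const_mul _ hg.of_uncurry_left, mul_comm]
      gcongr
      exact hC _
    refine (lmarginal_mono hstep x).trans ?_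
    have hsmul : lmarginal (fun _ => μ) s
        (C • fun y : ι → X => h (c y) * ∏ u ∈ s, g (c y) (y u)) x =
        C * lmarginal (fun _ => μ) s (fun y => h (c y) * ∏ u ∈ s, g (c y) (y u)) x :=
      lintegral_const_mul _ ((hm s).comp measurable_updateFinset)
    rw [hsmul, Finset.card_insert_of_notMem hi, pow_succ']
    calc _ ≤ C * (h (c x) * C ^ s.card) := by
          gcongr
          exact ih (fun j hj => hcs j (Finset.mem_insert_of_mem hj)) x
      _ = _ := by ring

/-- The star at a fixed centre is integrable over the positions of its leaves. -/
theorem lintegral_star_fixed_le {ι X : Type*} [Fintype ι] [MeasurableSpace X] {μ : Measure X}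
    [SigmaFinite μ] {g : X → X → ENNReal} (hg : Measurable g.uncurry) {C : ENNReal}
    (hC : ∀ x, ∫⁻ y, g x y ∂μ ≤ C) (x₀ : X) :
    ∫⁻ y : ι → X, ∏ u, g x₀ (y u) ∂Measure.pi (fun _ => μ) ≤ C ^ Fintype.card ι := by
  classical
  rw [lintegral_eq_lmarginal_univ fun _ => x₀]
  simpa using lmarginal_star_le hg hC measurable_one (measurable_const (a := x₀)) Finset.univ
    (fun _ _ _ _ => rfl) (fun _ => x₀)

/-- The star at a variable centre `v`, of which one leaf is fixed, is integrable over the positions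
of its centre and of its remaining leaves. -/
theorem lintegral_star_moving_le {ι X : Type*} [Fintype ι] [DecidableEq ι] [MeasurableSpace X]
    {μ : Measure X} [SigmaFinite μ] {g : X → X → ENNReal} (hg : Measurable g.uncurry)
    (hsymm : ∀ x y, g x y = g y x) {C : ENNReal} (hC : ∀ x, ∫⁻ y, g x y ∂μ ≤ C) (x₀ : X) (v : ι) :
    ∫⁻ y : ι → X, g (y v) x₀ * ∏ u ∈ Finset.univ.erase v, g (y v) (y u) ∂Measure.pi (fun _ => μ) ≤
      C ^ Fintype.card ι := by
  have hc : Measurable fun y : ι → X => y v := measurable_pi_apply v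
  have hh : Measurable fun x => g x x₀ := hg.comp measurable_prodMk_right
  rw [lintegral_eq_lmarginal_univ fun _ => x₀, lmarginal_erase _ _ (Finset.mem_univ v)]
  · refine (lintegral_mono fun z => lmarginal_star_le hg hC hh hc _ (fun i hi x z =>
      Function.update_of_ne (Finset.ne_of_mem_erase hi).symm _ _) _).trans ?_
    simp only [Function.update_self]
    rw [lintegral_mul_const _ hh, Finset.card_erase_of_mem (Finset.mem_univ v), Finset.card_univ]
    simp only [hsymm _ x₀]
    calc _ ≤ C * C ^ (Fintype.card ι - 1) := by gcongr; exact hC _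
      _ = _ := mul_pow_sub_one (Fintype.card_pos_iff.2 ⟨v⟩).ne' C
  · exact hh.comp hc |>.mul (Finset.measurable_prod _ fun u _ =>
      hg.comp (hc.prodMk (measurable_pi_apply u)))

/-- The edges of a complete graph that contain `v` correspond to the vertices other than `v`. -/
theorem prod_edges_containing {V M : Type*} [Fintype V] [DecidableEq V] [CommMonoid M]
    (f : Sym2 V → M) (v : V) :
    ∏ e ∈ (Finset.univ : Finset (⊤ : SimpleGraph V).edgeSet).filter (fun e => v ∈ e.1), f e =
      ∏ u ∈ Finset.univ.erase v, f s(v, u) := by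
  have hadj {u : V} (hu : u ∈ Finset.univ.erase v) : s(v, u) ∈ (⊤ : SimpleGraph V).edgeSet := by
    simpa [eq_comm] using hu
  refine (Finset.prod_bij (fun u hu => ⟨s(v, u), hadj hu⟩) ?_ ?_ ?_ ?_).symm
  · simp
  · intro u₁ _ u₂ _ h
    exact Sym2.congr_right.1 (Subtype.ext_iff.1 h)
  · rintro ⟨e, he⟩ hv
    obtain ⟨u, rfl⟩ : v ∈ e := by simpa using hv
    exact ⟨u, by simpa [eq_comm] using he, rfl⟩
  · exact fun _ _ => rfl

/-- Every edge has two ends, so the product over all edges, squared, is the product over all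
stars. -/
theorem prod_prod_star_eq_sq {V M : Type*} [Fintype V] [DecidableEq V] [CommMonoid M]
    (f : Sym2 V → M) :
    ∏ v, ∏ u ∈ Finset.univ.erase v, f s(v, u) =
      (∏ e : (⊤ : SimpleGraph V).edgeSet, f e) ^ 2 := by
  simp only [← prod_edges_containing]
  rw [Finset.prod_comm' (t' := Finset.univ) (s' := fun e => Finset.univ.filter (· ∈ e.1))
    (by simp), ← Finset.prod_pow]
  refine Finset.prod_congr rfl fun e _ => ?_
  rw [Finset.prod_const]
  congr 1
  obtain ⟨e, he⟩ := e
  induction e with | _ a b =>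
  have hab : a ≠ b := by simpa using he
  rw [← Finset.card_pair hab]
  congr 1
  ext
  simp

/-- On five vertices, the arithmetic-geometric mean inequality bounds the product over all edges
by a sum over the five stars, each factor being raised to the power `5 / 2`. -/
theorem prod_edges_le_sum_stars {f : Sym2 (Fin 5) → ℝ} (hf : ∀ e, 0 ≤ f e) :
    ∏ e : (⊤ : SimpleGraph (Fin 5)).edgeSet, f e ≤
      ∑ v, ∏ u ∈ Finset.univ.erase v, f s(v, u) ^ (5 / 2 : ℝ) := by
  have hP : 0 ≤ ∏ e : (⊤ : SimpleGraph (Fin 5)).edgeSet, f e := Finset.prod_nonneg fun e _ => hf e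
  have h := Real.geom_mean_le_arith_mean_weighted Finset.univ (fun _ : Fin 5 => (1 / 5 : ℝ))
    (fun v => ∏ u ∈ Finset.univ.erase v, f s(v, u) ^ (5 / 2 : ℝ)) (by simp) (by simp)
    (fun v _ => Finset.prod_nonneg fun u _ => Real.rpow_nonneg (hf _) _)
  rw [Real.finsetProd_rpow _ _ fun v _ => Finset.prod_nonneg fun u _ => Real.rpow_nonneg (hf _) _,
    prod_prod_star_eq_sq fun e => f e ^ (5 / 2 : ℝ),
    Real.finsetProd_rpow _ (fun e : (⊤ : SimpleGraph (Fin 5)).edgeSet => f e) fun e _ => hf e,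
    ← Real.rpow_natCast, ← Real.rpow_mul hP, ← Real.rpow_mul hP, ← Finset.mul_sum] at h
  -- the exponents on the left multiply to `(5 / 2) * 2 * (1 / 5) = 1`
  norm_num at h
  refine h.trans (mul_le_of_le_one_left ?_ (by norm_num))
  exact Finset.sum_nonneg fun v _ => Finset.prod_nonneg fun u _ => Real.rpow_nonneg (hf _) _

/-! ### Integrability of the 4-simplex -/

theorem placement_self {V : Type*} [DecidableEq V] (w : V) (x : Hyp3)
    (y : {v : V // v ≠ w} → Hyp3) : placement w x y w = x := by
  simp [placement]

theorem placement_coe {V : Type*} [DecidableEq V] (w : V) (x : Hyp3) (y : {v : V // v ≠ w} → Hyp3)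
    (v : {v : V // v ≠ w}) : placement w x y v = y v := by
  simp [placement, v.2]

theorem measurable_placement {V : Type*} [DecidableEq V] (w : V) (x : Hyp3) (v : V) :
    Measurable fun y : {v : V // v ≠ w} → Hyp3 => placement w x y v := by
  unfold placement
  split_ifs <;> fun_prop

theorem measurable_edgeFactor {V : Type*} [DecidableEq V] (p : ℝ) (w : V) (x : Hyp3) (e : Sym2 V) :
    Measurable fun y : {v : V // v ≠ w} → Hyp3 => edgeFactor p (placement w x y) e := by
  induction e with | _ a b =>
  exact (measurable_zonalKernel p).comp (measurable_hypDist.comp_pair (g := hypDist)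
    (measurable_placement w x a) (measurable_placement w x b))

theorem starWeight_comm (x y : Hyp3) : starWeight x y = starWeight y x := by
  rw [starWeight, hypDist_comm, starWeight]

theorem prod_erase_eq_prod_subtype {V M : Type*} [Fintype V] [DecidableEq V] [CommMonoid M] (w : V)
    (f : V → M) : ∏ u ∈ Finset.univ.erase w, f u = ∏ u : {v : V // v ≠ w}, f u :=
  Finset.prod_subtype _ (by simp) f

/-- Whichever vertex is held fixed, the star at each vertex `v` is integrable. -/
theorem lintegral_placement_star_lt_top {V : Type*} [Fintype V] [DecidableEq V] (w v : V)
    (x : Hyp3) :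
    ∫⁻ y : {v : V // v ≠ w} → Hyp3, ∏ u ∈ Finset.univ.erase v,
      starWeight (placement w x y v) (placement w x y u) ∂Measure.pi (fun _ => hypVolume) < ⊤ := by
  have hC (x : Hyp3) := (lintegral_starWeight x).le
  refine lt_of_le_of_lt ?_ (ENNReal.pow_lt_top (n := Fintype.card {v : V // v ≠ w})
    starConst_lt_top)
  by_cases hv : v = w
  · subst hv
    simp only [prod_erase_eq_prod_subtype, placement_self, placement_coe]
    exact lintegral_star_fixed_le measurable_starWeight hC x
  · lift v to {v : V // v ≠ w} using hv
    have hw : w ∈ Finset.univ.erase (v : V) := by simpa using v.2.symm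
    refine le_of_eq_of_le (lintegral_congr fun y => ?_)
      (lintegral_star_moving_le measurable_starWeight starWeight_comm hC x v)
    rw [← Finset.mul_prod_erase _ _ hw, placement_self, placement_coe]
    congr 1
    refine (Finset.prod_bij (fun (u : {v : V // v ≠ w}) _ => (u : V)) ?_ ?_ ?_ ?_).symm
    · intro u hu
      simpa [Subtype.ext_iff, u.2] using hu
    · intro _ _ _ _ h
      exact Subtype.ext h
    · intro u hu
      have hu' : u ≠ w ∧ u ≠ v := by simpa using hu
      exact ⟨⟨u, hu'.1⟩, by simpa [Subtype.ext_iff] using hu'.2, rfl⟩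
    · intro u _
      rw [placement_coe]

theorem mainTheorem3 : GraphIntegrable fourSimplexEnds := by
  intro p _ w x
  refine ⟨(Finset.measurable_prod _ fun e _ =>
    measurable_edgeFactor (p e) w x (fourSimplexEnds e)).aestronglyMeasurable, ?_⟩
  refine lt_of_le_of_lt (lintegral_mono fun y => ?_)
    ((lintegral_finsetSum (Finset.univ : Finset (Fin 5)) fun v _ => ?_).trans_lt
      (ENNReal.sum_lt_top.2 fun v _ => lintegral_placement_star_lt_top w v x))
  · have hnn (e : Sym2 (Fin 5)) : 0 ≤ edgeFactor 0 (placement w x y) e := by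
      induction e with | _ a b => exact zonalKernel_zero_nonneg _
    have hle (q : ℝ) (e : Sym2 (Fin 5)) :
        |edgeFactor q (placement w x y) e| ≤ edgeFactor 0 (placement w x y) e := by
      induction e with | _ a b => exact abs_zonalKernel_le _ _
    rw [← ofReal_norm, Real.norm_eq_abs, Finset.abs_prod]
    refine (ENNReal.ofReal_le_ofReal ((Finset.prod_le_prod (fun _ _ => abs_nonneg _)
      fun e _ => hle (p e) e.1).trans (prod_edges_le_sum_stars hnn))).trans_eq ?_
    rw [ENNReal.ofReal_sum_of_nonneg fun v _ =>
      Finset.prod_nonneg fun u _ => Real.rpow_nonneg (hnn _) _]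
    refine Finset.sum_congr rfl fun v _ => ?_
    rw [ENNReal.ofReal_prod_of_nonneg fun u _ => Real.rpow_nonneg (hnn _) _]
    rfl
  · exact Finset.measurable_prod _ fun u _ => measurable_starWeight.comp_pair (g := starWeight)
      (measurable_placement w x v) (measurable_placement w x u)
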